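/- Let $\Omega>0$ and $\gamma>0$. Let $\theta=\ln\frac{\Omega}{2\sinh\gamma}$ (missed-detection case) or $\theta=\ln\frac{\Omega}{2\sinh\gamma}-\ln(1+\Omega)$ (false-alarm case), and assume $\theta\neq\gamma$. Put $\alpha(x)=\cosh\gamma-\cosh x+\sinh\gamma\,(x-\gamma)$ for $x\in\mathbb C$. Define $t:\mathbb R\to\mathbb C$ by $t(0)=e^{\gamma}$ and, for real $u\ne0$, let $t(u)$ be the solution $x\in\mathbb C$ of $$\operatorname{sign}(\operatorname{Im}x)\,\sqrt{2\,\alpha(\ln x)}=u$$ (principal logarithm and square root). Let $$f(u)=\frac{t'(u)}{e^{\theta}-t(u)},\qquad g_n(\gamma)=\frac1\pi\int_0^\infty \operatorname{Im}[f(u)]\;e^{-n u^2/(4\sinh\gamma)}\,du .$$ Then $t(u)$ is uniquely determined for every $u\neq 0$, $t$ is differentiable on $\mathbb R$, and the integral converges absolutely for every real $n\ge1$. Near $u=0$ the function $f$ is the sum of its Taylor series, $f(u)=i\sum_{k\ge0}c_ku^k$, and the coefficients $c_{2k}$ are real. Moreover $g_n(\gamma)$ has the asymptotic expansion $$g_n(\gamma)\sim\frac1{2\sqrt\pi}\sum_{k=0}^\infty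 c_{2k}\,\frac{\Gamma(k+\frac12)}{\Gamma(\frac12)}\left(\frac{4\sinh\gamma}{n}\right)^{k+\frac12},$$ uniformly in $n\in[1,\infty)$, in the following sense: for every integer $K\ge0$ there is a constant $C$, which may depend on $\Omega$, $\gamma$, the case (missed detection or false alarm) and $K$ but not on $n$, such that for all real $n\ge1$ $$\left|g_n(\gamma)-\frac1{2\sqrt\pi}\sum_{k=0}^{K-1}c_{2k}\,\frac{\Gamma(k+\frac12)}{\Gamma(\frac12)}\left(\frac{4\sinh\gamma}{n}\right)^{k+\frac12}\right|\le C\,n^{-K-\frac12}.$$ -/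

import Mathlib

namespace AWGNConverse

noncomputable section

/-- The two error probabilities: missed detection and false alarm. -/
inductive ErrorKind where
  | MD
  | FA

/-- The saddle-point parameter `θ(γ)`, for signal-to-noise ratio `Ω`, in the MD and FA cases. -/
def theta (Ω : ℝ) (e : ErrorKind) (γ : ℝ) : ℝ :=
  Real.log (Ω / (2 * Real.sinh γ)) +
    match e with
    | ErrorKind.MD => 0
    | ErrorKind.FA => -Real.log (1 + Ω)

/-- `α(x) = cosh γ - cosh x + sinh γ (x - γ)`, as a function of a complex variable. -/
def alpha (γ : ℝ) (x : ℂ) : ℂ :=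
  (Real.cosh γ : ℂ) - Complex.cosh x + (Real.sinh γ : ℂ) * (x - (γ : ℂ))

/-- `t⁻¹(x) = sign(Im x) √(2 α(ln x))`, with the principal logarithm and square root. -/
def tInv (γ : ℝ) (x : ℂ) : ℂ :=
  (Real.sign x.im : ℂ) * (2 * alpha γ (Complex.log x)) ^ (1 / 2 : ℂ)

open Classical in
/-- The function `t` on the real line given by the inverse relation `tInv γ (t u) = u`.
For `u ≠ 0` this equation has exactly one complex solution. For `u = 0` the factor `sign(Im x)`
alone makes every real `x` a solution; the value of `t` there is the saddle point `exp γ`, the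
zero of `α ∘ ln` and the limit of `t u` as `u` tends to `0`. -/
def t (γ : ℝ) (u : ℝ) : ℂ :=
  if u = 0 then (Real.exp γ : ℂ)
  else if h : ∃ x : ℂ, tInv γ x = (u : ℂ) then h.choose
  else 0

/-- `f(u) = t'(u) / (exp θ - t(u))`. -/
def f (Ω : ℝ) (e : ErrorKind) (γ : ℝ) (u : ℝ) : ℂ :=
  deriv (t γ) u / ((Real.exp (theta Ω e γ) : ℂ) - t γ u)

/-- The integrand `Im f(u) · exp(-n u² / (4 sinh γ))` of `g`. -/
def gIntegrand (Ω : ℝ) (e : ErrorKind) (γ n : ℝ) (u : ℝ) : ℝ :=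
  (f Ω e γ u).im * Real.exp (-(n * u ^ 2 / (4 * Real.sinh γ)))

/-- `g(γ) = (1/π) ∫₀^∞ Im f(u) exp(-n u² / (4 sinh γ)) du`. -/
def g (Ω : ℝ) (e : ErrorKind) (γ n : ℝ) : ℝ :=
  1 / Real.pi * ∫ u in Set.Ioi (0 : ℝ), gIntegrand Ω e γ n u

/-- The coefficients `c_k` in the Taylor expansion `f(u) = i ∑ c_k u^k` at `u = 0`. -/
def c (Ω : ℝ) (e : ErrorKind) (γ : ℝ) (k : ℕ) : ℂ :=
  -Complex.I * (iteratedDeriv k (f Ω e γ) 0 / (k.factorial : ℂ))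

end

end AWGNConverse

namespace AWGNConverse

noncomputable section

open Filter Topology Set Asymptotics MeasureTheory

/-! In the coordinate `w = log x = a + ib` the equation for `t` asks that `alpha γ w` be the real
number `u²/2`, with `b` of the sign of `u`. For `0 < |b| < π` its imaginary part vanishes exactly
when `sinh a · sin b = sinh γ · b`, which determines `a = contourRe γ b`. This branch extends
analytically through the saddle point `a = γ`, `b = 0`, so the solutions lie on a single curve
parametrized by `b`. Along it `alpha` has a strict minimum `0` at `b = 0` and tends to infinity as
`b → ±π`, so its odd square root `contourParam` is an analytic increasing bijection from `(-π, π)`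
onto `ℝ`. Its inverse `contourArg` gives `t u = exp (logPath γ u)` (`tInv_eq_iff`,
`t_eq_exp_logPath`), analytic on all of `ℝ`.

Hence `f` is analytic wherever `t u ≠ exp θ`. Reflection in the real axis gives `f (-u) = -conj (f
u)`, so only even powers survive in `Im f`. At infinity `f` grows at most linearly (`norm_f_le`).
These are the inputs of Watson's lemma (`watson_gaussian`), which integrates the Taylor polynomial
against the Gaussian and bounds the remainder uniformly in `n ≥ 1`. -/

/-- The real part of the point of imaginary part `b` on the curve where `alpha γ` is real. -/
def contourRe (γ b : ℝ) : ℝ := Real.arsinh (Real.sinh γ / Real.sinc b)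

/-- The value of `alpha γ` at the point of imaginary part `b` of the curve. -/
def contourHeight (γ b : ℝ) : ℝ :=
  Real.cosh γ - Real.cosh (contourRe γ b) * Real.cos b + Real.sinh γ * (contourRe γ b - γ)

/-- The analytic odd square root of `2 * contourHeight γ`. -/
def contourParam (γ b : ℝ) : ℝ :=
  b * Real.sqrt (2 * dslope (dslope (contourHeight γ) 0) 0 b)

/-! ### Analyticity of `sinc` and of divided differences. -/

lemma sinc_pos {b : ℝ} (hb : b ∈ Ioo (-Real.pi) Real.pi) : 0 < Real.sinc b := by
  rcases lt_trichotomy b 0 with h | h | h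
  · rw [← Real.sinc_neg, Real.sinc_of_ne_zero (by linarith)]
    exact div_pos (Real.sin_pos_of_pos_of_lt_pi (by linarith) (by linarith [hb.1])) (by linarith)
  · simp [h]
  · rw [Real.sinc_of_ne_zero h.ne']
    exact div_pos (Real.sin_pos_of_pos_of_lt_pi h hb.2) h

lemma sinc_mul_self (b : ℝ) : Real.sinc b * b = Real.sin b := by
  rcases eq_or_ne b 0 with rfl | h
  · simp
  · rw [Real.sinc_of_ne_zero h]; field_simp

lemma analyticAt_dslope_self {f : ℝ → ℝ} {a : ℝ} (h : AnalyticAt ℝ f a) :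
    AnalyticAt ℝ (dslope f a) a := by
  obtain ⟨p, hp⟩ := h
  exact hp.has_fpower_series_dslope_fslope.analyticAt

lemma analyticAt_dslope {f : ℝ → ℝ} {a b : ℝ} (ha : AnalyticAt ℝ f a)
    (hb : AnalyticAt ℝ f b) : AnalyticAt ℝ (dslope f a) b := by
  rcases eq_or_ne b a with rfl | h
  · exact analyticAt_dslope_self ha
  · refine AnalyticAt.congr (f := fun x => (x - a)⁻¹ * (f x - f a)) ?_ ?_
    · exact ((analyticAt_id.sub analyticAt_const).inv (sub_ne_zero.2 h)).mul
        (hb.sub analyticAt_const)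
    · filter_upwards [isOpen_ne.mem_nhds h] with x hx
      rw [dslope_of_ne _ hx, slope_def_field]; ring

lemma analyticAt_sinc (b : ℝ) : AnalyticAt ℝ Real.sinc b := by
  rw [Real.sinc_eq_dslope]
  exact analyticAt_dslope Real.analyticAt_sin Real.analyticAt_sin

/-! ### The curve through the saddle point and the height along it. -/

variable {γ b : ℝ}

lemma analyticAt_contourRe (hb : b ∈ Ioo (-Real.pi) Real.pi) :
    AnalyticAt ℝ (contourRe γ) b :=
  Real.analyticAt_arsinh.comp (f := fun b => Real.sinh γ / Real.sinc b)
    (analyticAt_const.div (analyticAt_sinc b) (sinc_pos hb).ne')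

lemma analyticAt_contourHeight (hb : b ∈ Ioo (-Real.pi) Real.pi) :
    AnalyticAt ℝ (contourHeight γ) b := by
  have h := analyticAt_contourRe (γ := γ) hb
  exact (analyticAt_const.sub ((Real.analyticAt_cosh.comp h).mul Real.analyticAt_cos)).add
    (analyticAt_const.mul (h.sub analyticAt_const))

lemma contourRe_neg (b : ℝ) : contourRe γ (-b) = contourRe γ b := by
  simp [contourRe, Real.sinc_neg]

lemma contourHeight_neg (b : ℝ) : contourHeight γ (-b) = contourHeight γ b := by
  simp [contourHeight, contourRe_neg]

lemma contourRe_zero : contourRe γ 0 = γ := by simp [contourRe]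

lemma contourHeight_zero : contourHeight γ 0 = 0 := by simp [contourHeight, contourRe_zero]

lemma sinh_contourRe_mul_sin (hb : b ∈ Ioo (-Real.pi) Real.pi) :
    Real.sinh (contourRe γ b) * Real.sin b = Real.sinh γ * b := by
  have := (sinc_pos hb).ne'
  rw [contourRe, Real.sinh_arsinh, ← sinc_mul_self b]
  field_simp

/-- At `b = 0` every `a` satisfies the equation: the real axis is a second branch of the zero set,
hence `b ≠ 0`. -/
lemma contourRe_eq_of_sinh_mul_sin {a : ℝ} (hb : b ∈ Ioo (-Real.pi) Real.pi) (hb0 : b ≠ 0)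
    (h : Real.sinh a * Real.sin b = Real.sinh γ * b) : a = contourRe γ b := by
  have h1 := (sinc_pos hb).ne'
  rw [contourRe, eq_comm, ← Real.arsinh_sinh a]
  congr 1
  rw [← sinc_mul_self b, ← mul_assoc] at h
  rw [div_eq_iff h1]
  exact (mul_right_cancel₀ hb0 h).symm

/-- With `A = contourRe γ`, the derivative is `cosh A sin b + (sinh γ - sinh A cos b) A'`.
Differentiating the constraint `sinh A sin b = sinh γ · b` turns the bracket into `cosh A sin b ·
A'`, so the total is `cosh A sin b (1 + A'²)`. -/
lemma deriv_contourHeight_ge (hb0 : 0 < b) (hb : b < Real.pi) :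
    Real.sin b ≤ deriv (contourHeight γ) b := by
  have hmem : b ∈ Ioo (-Real.pi) Real.pi := ⟨by linarith, hb⟩
  have hA := (analyticAt_contourRe (γ := γ) hmem).differentiableAt.hasDerivAt
  set A' := deriv (contourRe γ) b
  have hs := Real.sin_pos_of_pos_of_lt_pi hb0 hb
  have hc := Real.one_le_cosh (contourRe γ b)
  have h1 : HasDerivAt (fun b => Real.sinh (contourRe γ b) * Real.sin b)
      (Real.cosh (contourRe γ b) * A' * Real.sin b + Real.sinh (contourRe γ b) * Real.cos b) b :=
    hA.sinh.mul (Real.hasDerivAt_sin b)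
  have h2 : HasDerivAt (fun b => Real.sinh (contourRe γ b) * Real.sin b) (Real.sinh γ * 1) b := by
    refine ((hasDerivAt_id b).const_mul (Real.sinh γ)).congr_of_eventuallyEq ?_
    filter_upwards [isOpen_Ioo.mem_nhds hmem] with x hx using sinh_contourRe_mul_sin hx
  have h3 := h1.unique h2
  have h4 : HasDerivAt (contourHeight γ)
      (0 - (Real.sinh (contourRe γ b) * A' * Real.cos b
        + Real.cosh (contourRe γ b) * (-Real.sin b)) + Real.sinh γ * (A' - 0)) b :=
    ((hasDerivAt_const b _).sub (hA.cosh.mul (Real.hasDerivAt_cos b))).add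
      ((hA.sub (hasDerivAt_const b _)).const_mul _)
  rw [h4.deriv]
  have h5 : Real.cosh (contourRe γ b) * Real.sin b * A'
      = Real.sinh γ - Real.sinh (contourRe γ b) * Real.cos b := by linarith
  have h6 : 0 ≤ (Real.sinh γ - Real.sinh (contourRe γ b) * Real.cos b) * A' := by
    rw [← h5]
    have : 0 ≤ Real.cosh (contourRe γ b) * Real.sin b := by positivity
    nlinarith [mul_nonneg this (mul_self_nonneg A')]
  nlinarith

lemma continuousOn_contourHeight : ContinuousOn (contourHeight γ) (Ioo (-Real.pi) Real.pi) :=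
  fun _ hx => (analyticAt_contourHeight hx).continuousAt.continuousWithinAt

lemma contourHeight_ge_of_nonneg (hb0 : 0 ≤ b) (hb : b < Real.pi) :
    1 - Real.cos b ≤ contourHeight γ b := by
  have hmono : MonotoneOn (fun x => contourHeight γ x - (1 - Real.cos x)) (Ico 0 Real.pi) := by
    apply monotoneOn_of_deriv_nonneg (convex_Ico _ _)
    · exact (continuousOn_contourHeight.mono fun x hx =>
        ⟨by linarith [hx.1, Real.pi_pos], hx.2⟩).sub (by fun_prop)
    · intro x hx
      rw [interior_Ico] at hx
      exact ((analyticAt_contourHeight ⟨by linarith [hx.1, Real.pi_pos], hx.2⟩).differentiableAt.sub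
        (by fun_prop)).differentiableWithinAt
    · intro x hx
      rw [interior_Ico] at hx
      have h := (analyticAt_contourHeight (γ := γ)
        ⟨by linarith [hx.1, Real.pi_pos], hx.2⟩).differentiableAt.hasDerivAt
      have h' : HasDerivAt (fun x => contourHeight γ x - (1 - Real.cos x))
          (deriv (contourHeight γ) x - (0 - -Real.sin x)) x :=
        h.sub ((hasDerivAt_const x 1).sub (Real.hasDerivAt_cos x))
      rw [h'.deriv]
      linarith [deriv_contourHeight_ge (γ := γ) hx.1 hx.2]
  have := hmono ⟨le_rfl, Real.pi_pos⟩ ⟨hb0, hb⟩ hb0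
  simpa [contourHeight_zero] using this

lemma contourHeight_ge (hb : b ∈ Ioo (-Real.pi) Real.pi) :
    2 / Real.pi ^ 2 * b ^ 2 ≤ contourHeight γ b := by
  have h1 : 1 - Real.cos b ≤ contourHeight γ b := by
    rcases le_total 0 b with h | h
    · exact contourHeight_ge_of_nonneg h hb.2
    · rw [← Real.cos_neg, ← contourHeight_neg]
      exact contourHeight_ge_of_nonneg (by linarith) (by linarith [hb.1])
  linarith [Real.cos_le_one_sub_mul_cos_sq (abs_le.2 ⟨hb.1.le, hb.2.le⟩)]

lemma zero_mem_Ioo_pi : (0 : ℝ) ∈ Ioo (-Real.pi) Real.pi := ⟨by linarith [Real.pi_pos], Real.pi_pos⟩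

lemma neg_mem_Ioo_pi (hb : b ∈ Ioo (-Real.pi) Real.pi) : -b ∈ Ioo (-Real.pi) Real.pi :=
  ⟨by linarith [hb.2], by linarith [hb.1]⟩

lemma deriv_contourHeight_zero : deriv (contourHeight γ) 0 = 0 := by
  have h := (analyticAt_contourHeight (γ := γ) zero_mem_Ioo_pi).differentiableAt.hasDerivAt
  have h2 : HasDerivAt (fun x => contourHeight γ (-x)) (deriv (contourHeight γ) 0 * -1) 0 := by
    refine HasDerivAt.comp (0 : ℝ) (h₂ := contourHeight γ) ?_ (hasDerivAt_neg 0)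
    simpa using h
  simp only [contourHeight_neg] at h2
  linarith [h.unique h2]

lemma dslope_dslope_contourHeight_of_ne (hb : b ≠ 0) :
    dslope (dslope (contourHeight γ) 0) 0 b = contourHeight γ b / b ^ 2 := by
  rw [dslope_of_ne _ hb, slope_def_field, dslope_same, dslope_of_ne _ hb, slope_def_field,
    deriv_contourHeight_zero, contourHeight_zero]
  field_simp
  ring

lemma analyticAt_dslope_dslope_contourHeight (hb : b ∈ Ioo (-Real.pi) Real.pi) :
    AnalyticAt ℝ (dslope (dslope (contourHeight γ) 0) 0) b :=
  have h0 := analyticAt_contourHeight (γ := γ) zero_mem_Ioo_pi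
  analyticAt_dslope (analyticAt_dslope h0 h0) (analyticAt_dslope h0 (analyticAt_contourHeight hb))

/-- The quadratic lower bound on the height keeps the quotient by `b²` at least `2/π²`; the value at
`0` inherits this as a limit. Positivity there is what makes the square root in `contourParam`
analytic across the saddle point. -/
lemma dslope_dslope_contourHeight_pos (hb : b ∈ Ioo (-Real.pi) Real.pi) :
    0 < dslope (dslope (contourHeight γ) 0) 0 b := by
  have hpi := Real.pi_pos
  have key : ∀ x ∈ Ioo (-Real.pi) Real.pi, x ≠ 0 →
      2 / Real.pi ^ 2 ≤ dslope (dslope (contourHeight γ) 0) 0 x := by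
    intro x hx h
    have : 0 < x ^ 2 := by positivity
    rw [dslope_dslope_contourHeight_of_ne h, le_div_iff₀ this]
    exact contourHeight_ge hx
  have hpos : 0 < 2 / Real.pi ^ 2 := by positivity
  rcases eq_or_ne b 0 with rfl | h
  · have hlim : Tendsto (dslope (dslope (contourHeight γ) 0) 0) (𝓝[≠] 0)
        (𝓝 (dslope (dslope (contourHeight γ) 0) 0 0)) :=
      (analyticAt_dslope_dslope_contourHeight hb).continuousAt.tendsto.mono_left nhdsWithin_le_nhds
    refine hpos.trans_le (ge_of_tendsto hlim ?_)
    filter_upwards [self_mem_nhdsWithin, nhdsWithin_le_nhds (isOpen_Ioo.mem_nhds hb)] with x h1 h2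
      using key x h2 h1
  · exact hpos.trans_le (key b hb h)

/-! ### The odd square root as a bijection onto the line. -/

lemma analyticAt_contourParam (hb : b ∈ Ioo (-Real.pi) Real.pi) :
    AnalyticAt ℝ (contourParam γ) b := by
  have h : AnalyticAt ℝ (fun b => 2 * dslope (dslope (contourHeight γ) 0) 0 b) b :=
    analyticAt_const.mul (analyticAt_dslope_dslope_contourHeight hb)
  have h2 : ContDiffAt ℝ ⊤ (fun b => Real.sqrt (2 * dslope (dslope (contourHeight γ) 0) 0 b)) b :=
    h.contDiffAt.sqrt (by linarith [dslope_dslope_contourHeight_pos (γ := γ) hb])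
  exact analyticAt_id.mul h2.analyticAt

lemma contourParam_zero : contourParam γ 0 = 0 := by simp [contourParam]

lemma contourParam_sq (hb : b ∈ Ioo (-Real.pi) Real.pi) :
    contourParam γ b ^ 2 = 2 * contourHeight γ b := by
  rw [contourParam, mul_pow,
    Real.sq_sqrt (by linarith [dslope_dslope_contourHeight_pos (γ := γ) hb])]
  rcases eq_or_ne b 0 with rfl | h
  · simp [contourHeight_zero]
  · rw [dslope_dslope_contourHeight_of_ne h]; field_simp

lemma contourParam_neg (b : ℝ) : contourParam γ (-b) = -contourParam γ b := by
  rcases eq_or_ne b 0 with rfl | h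
  · simp [contourParam_zero]
  · rw [contourParam, contourParam, dslope_dslope_contourHeight_of_ne h,
      dslope_dslope_contourHeight_of_ne (neg_ne_zero.2 h), contourHeight_neg]
    ring_nf

lemma contourParam_pos (hb0 : 0 < b) (hb : b < Real.pi) : 0 < contourParam γ b :=
  mul_pos hb0 (Real.sqrt_pos.2 (by
    linarith [dslope_dslope_contourHeight_pos (γ := γ) ⟨by linarith, hb⟩]))

lemma deriv_contourParam_mul_of_mem (hb : b ∈ Ioo (-Real.pi) Real.pi) :
    contourParam γ b * deriv (contourParam γ) b = deriv (contourHeight γ) b := by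
  have h1 := (analyticAt_contourParam (γ := γ) hb).differentiableAt.hasDerivAt.pow 2
  have h2 : HasDerivAt (contourParam γ ^ 2) (2 * deriv (contourHeight γ) b) b := by
    refine ((analyticAt_contourHeight (γ := γ) hb).differentiableAt.hasDerivAt.const_mul
      2).congr_of_eventuallyEq ?_
    filter_upwards [isOpen_Ioo.mem_nhds hb] with x hx using contourParam_sq hx
  have := h1.unique h2
  simp at this
  linarith

/-- Away from `0` the sign comes from `contourParam * contourParam' = contourHeight'` and oddness.
At `0` that identity reads `0 = 0`, and the derivative is instead the value of the square-root
factor. -/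
lemma deriv_contourParam_pos (hb : b ∈ Ioo (-Real.pi) Real.pi) :
    0 < deriv (contourParam γ) b := by
  have pos : ∀ x, 0 < x → x < Real.pi → 0 < deriv (contourParam γ) x := by
    intro x h0 h1
    have h2 := deriv_contourHeight_ge (γ := γ) h0 h1
    rw [← deriv_contourParam_mul_of_mem ⟨by linarith, h1⟩] at h2
    exact (pos_iff_pos_of_mul_pos
      ((Real.sin_pos_of_pos_of_lt_pi h0 h1).trans_le h2)).1 (contourParam_pos h0 h1)
  rcases lt_trichotomy b 0 with h | rfl | h
  · have h1 := pos (-b) (by linarith) (by linarith [hb.1])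
    have h2 := deriv_comp_neg (contourParam γ) b
    simp only [contourParam_neg, deriv.fun_neg] at h2
    linarith
  · have h2 : ContinuousAt (fun b => Real.sqrt (2 * dslope (dslope (contourHeight γ) 0) 0 b)) 0 :=
      ((analyticAt_dslope_dslope_contourHeight hb).continuousAt.const_mul 2).sqrt
    have h3 : HasDerivAt (contourParam γ)
        (Real.sqrt (2 * dslope (dslope (contourHeight γ) 0) 0 0)) 0 := by
      rw [hasDerivAt_iff_tendsto_slope]
      refine (h2.tendsto.mono_left nhdsWithin_le_nhds).congr' ?_
      filter_upwards [self_mem_nhdsWithin] with x hx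
      rw [slope_def_field, contourParam_zero, contourParam, sub_zero, sub_zero,
        mul_div_cancel_left₀ _ hx]
    rw [h3.deriv]
    exact Real.sqrt_pos.2 (by linarith [dslope_dslope_contourHeight_pos (γ := γ) hb])
  · exact pos b h hb.2

lemma continuousOn_contourParam : ContinuousOn (contourParam γ) (Ioo (-Real.pi) Real.pi) :=
  fun _ hx => (analyticAt_contourParam hx).continuousAt.continuousWithinAt

lemma strictMonoOn_contourParam : StrictMonoOn (contourParam γ) (Ioo (-Real.pi) Real.pi) := by
  apply strictMonoOn_of_deriv_pos (convex_Ioo _ _) continuousOn_contourParam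
  intro x hx
  rw [interior_Ioo] at hx
  exact deriv_contourParam_pos hx

/-- Near `π` the sine is small while `sinh a · sin b = sinh γ · b` stays away from `0`, which forces
`a` to be large. Staying beyond `π / 2` also ensures `cos b ≤ 0` and `b ≥ 1`. -/
lemma exists_forall_le_contourRe (hγ : 0 < γ) (M : ℝ) :
    ∃ b₀ ∈ Ico (Real.pi / 2) Real.pi, ∀ b ∈ Ico b₀ Real.pi, M ≤ contourRe γ b := by
  have hpi := Real.pi_gt_three
  have hs := Real.sinh_pos_iff.2 hγ
  -- The maximum with `1` only keeps the divisor positive when `M ≤ 0`.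
  set N := max (Real.sinh M) 1
  have hN : 0 < N := by positivity
  refine ⟨Real.pi - min (Real.pi / 2) (Real.sinh γ / N), ⟨?_, ?_⟩, fun b hb => ?_⟩
  · linarith [min_le_left (Real.pi / 2) (Real.sinh γ / N)]
  · have : 0 < min (Real.pi / 2) (Real.sinh γ / N) := by positivity
    linarith
  · have hb1 : Real.pi / 2 ≤ b := by linarith [hb.1, min_le_left (Real.pi / 2) (Real.sinh γ / N)]
    have hmem : b ∈ Ioo (-Real.pi) Real.pi := ⟨by linarith, hb.2⟩
    have hsin := Real.sin_pos_of_pos_of_lt_pi (by linarith : 0 < b) hb.2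
    have h1 : Real.sin b ≤ Real.sinh γ / N := by
      rw [← Real.sin_pi_sub]
      have h2 := Real.sin_le (by linarith [hb.2] : 0 ≤ Real.pi - b)
      linarith [hb.1, min_le_right (Real.pi / 2) (Real.sinh γ / N)]
    rw [le_div_iff₀ hN] at h1
    have h2 := sinh_contourRe_mul_sin (γ := γ) hmem
    rw [← Real.sinh_le_sinh]
    refine (le_max_left _ 1).trans ?_
    refine le_of_mul_le_mul_right ?_ hsin
    rw [h2, mul_comm]
    nlinarith

lemma surjOn_contourParam (hγ : 0 < γ) :
    SurjOn (contourParam γ) (Ioo (-Real.pi) Real.pi) univ := by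
  have pos : ∀ u, 0 ≤ u → ∃ b ∈ Ioo (-Real.pi) Real.pi, contourParam γ b = u := by
    intro u hu
    have hs := Real.sinh_pos_iff.2 hγ
    have hpi := Real.pi_pos
    -- This threshold makes the linear term `sinh γ (a - γ)` at least `u²`; the cosine term only
    -- helps, since `cos b₀ ≤ 0`.
    obtain ⟨b₀, hb₀, h⟩ := exists_forall_le_contourRe hγ (γ + u ^ 2 / Real.sinh γ)
    have hle := h b₀ ⟨le_rfl, hb₀.2⟩
    have h0 : 0 < b₀ := by linarith [hb₀.1]
    have hmem : b₀ ∈ Ioo (-Real.pi) Real.pi := ⟨by linarith, hb₀.2⟩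
    have h1 : u ^ 2 ≤ contourHeight γ b₀ := by
      have hcos : Real.cos b₀ ≤ 0 :=
        Real.cos_nonpos_of_pi_div_two_le_of_le hb₀.1 (by linarith [hb₀.2])
      have : Real.sinh γ * (u ^ 2 / Real.sinh γ) ≤ Real.sinh γ * (contourRe γ b₀ - γ) := by
        gcongr; linarith
      rw [mul_div_cancel₀ _ hs.ne'] at this
      have hc := Real.cosh_pos γ
      have hc2 := Real.cosh_pos (contourRe γ b₀)
      unfold contourHeight
      nlinarith
    have h2 : u ≤ contourParam γ b₀ := by
      refine le_of_sq_le_sq ?_ (contourParam_pos h0 hb₀.2).le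
      rw [contourParam_sq hmem]
      nlinarith
    have hsub : Icc 0 b₀ ⊆ Ioo (-Real.pi) Real.pi := fun x hx =>
      ⟨by linarith [hx.1], by linarith [hx.2, hb₀.2]⟩
    obtain ⟨b, hb, hbu⟩ := intermediate_value_Icc h0.le
      (continuousOn_contourParam (γ := γ) |>.mono hsub) ⟨by rwa [contourParam_zero], h2⟩
    exact ⟨b, hsub hb, hbu⟩
  intro u _
  rcases le_total 0 u with h | h
  · exact pos u h
  · obtain ⟨b, hb, hbu⟩ := pos (-u) (by linarith)
    exact ⟨-b, neg_mem_Ioo_pi hb, by rw [contourParam_neg, hbu, neg_neg]⟩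

/-! ### The inverse of the parameter and the path of `log t`. -/

/-- The imaginary part of `log (t γ u)`. -/
def contourArg (γ u : ℝ) : ℝ := Function.invFunOn (contourParam γ) (Ioo (-Real.pi) Real.pi) u

/-- The curve `log (t γ u)`. -/
def logPath (γ u : ℝ) : ℂ := (contourRe γ (contourArg γ u) : ℂ) + (contourArg γ u : ℂ) * Complex.I

variable {u : ℝ}

lemma contourArg_mem (hγ : 0 < γ) (u : ℝ) : contourArg γ u ∈ Ioo (-Real.pi) Real.pi :=
  Function.invFunOn_mem (surjOn_contourParam hγ (mem_univ u))

lemma contourParam_contourArg (hγ : 0 < γ) (u : ℝ) : contourParam γ (contourArg γ u) = u :=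
  Function.invFunOn_eq (surjOn_contourParam hγ (mem_univ u))

lemma contourArg_eq (hγ : 0 < γ) (hb : b ∈ Ioo (-Real.pi) Real.pi) (h : contourParam γ b = u) :
    contourArg γ u = b :=
  strictMonoOn_contourParam.injOn (contourArg_mem hγ u) hb
    ((contourParam_contourArg hγ u).trans h.symm)

lemma contourArg_neg (hγ : 0 < γ) (u : ℝ) : contourArg γ (-u) = -contourArg γ u :=
  contourArg_eq hγ (neg_mem_Ioo_pi (contourArg_mem hγ u))
    (by rw [contourParam_neg, contourParam_contourArg hγ])

lemma contourArg_zero (hγ : 0 < γ) : contourArg γ 0 = 0 :=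
  contourArg_eq hγ zero_mem_Ioo_pi contourParam_zero

lemma contourArg_pos (hγ : 0 < γ) (hu : 0 < u) : 0 < contourArg γ u := by
  rw [← contourParam_contourArg hγ u, ← contourParam_zero (γ := γ)] at hu
  exact (strictMonoOn_contourParam.lt_iff_lt zero_mem_Ioo_pi (contourArg_mem hγ u)).1 hu

/-- The analytic local inverse of `contourParam` stays in `(-π, π)` near `u` by continuity, and
there injectivity identifies it with `contourArg`. -/
lemma analyticAt_contourArg (hγ : 0 < γ) (u : ℝ) : AnalyticAt ℝ (contourArg γ) u := by
  have hmem := contourArg_mem hγ u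
  have ha := analyticAt_contourParam (γ := γ) hmem
  have h0 := (deriv_contourParam_pos (γ := γ) hmem).ne'
  have hinv := ha.analyticAt_localInverse h0
  have hself : ha.hasStrictDerivAt.localInverse _ _ _ h0 (contourParam γ (contourArg γ u))
      = contourArg γ u := HasStrictFDerivAt.localInverse_apply_image ..
  have hcont := hinv.continuousAt
  rw [ContinuousAt, hself] at hcont
  have hr := HasStrictDerivAt.eventually_right_inverse ha.hasStrictDerivAt h0
  rw [contourParam_contourArg hγ u] at hinv hcont hr
  refine hinv.congr ?_
  filter_upwards [hr, hcont (isOpen_Ioo.mem_nhds hmem)] with x hx1 hx2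
  exact (contourArg_eq hγ hx2 hx1).symm

/-! ### Solving the equation that defines `t`. -/

lemma two_mul_add_mul_I_eq_ofReal {p q r : ℝ}
    (h : 2 * ((p : ℂ) + (q : ℂ) * Complex.I) = (r : ℂ)) : 2 * p = r ∧ q = 0 := by
  have hre := congrArg Complex.re h
  have him := congrArg Complex.im h
  simp at hre him
  exact ⟨hre, him⟩

lemma alpha_add_mul_I (γ a b : ℝ) :
    alpha γ ((a : ℂ) + (b : ℂ) * Complex.I) =
      ((Real.cosh γ - Real.cosh a * Real.cos b + Real.sinh γ * (a - γ) : ℝ) : ℂ) +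
        ((Real.sinh γ * b - Real.sinh a * Real.sin b : ℝ) : ℂ) * Complex.I := by
  rw [alpha, Complex.cosh_add, Complex.cosh_mul_I, Complex.sinh_mul_I]
  push_cast
  ring

lemma alpha_logPath (hγ : 0 < γ) (u : ℝ) : alpha γ (logPath γ u) = ((u ^ 2 / 2 : ℝ) : ℂ) := by
  have hmem := contourArg_mem hγ u
  have h := contourParam_sq (γ := γ) hmem
  rw [contourParam_contourArg hγ u] at h
  rw [logPath, alpha_add_mul_I, sinh_contourRe_mul_sin hmem, sub_self, ← contourHeight]
  simp [h]

lemma exp_logPath_im (γ u : ℝ) : (Complex.exp (logPath γ u)).im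
    = Real.exp (contourRe γ (contourArg γ u)) * Real.sin (contourArg γ u) := by
  rw [Complex.exp_im]; simp [logPath]

lemma exp_logPath_im_pos (hγ : 0 < γ) (hu : 0 < u) : 0 < (Complex.exp (logPath γ u)).im := by
  rw [exp_logPath_im]
  exact mul_pos (Real.exp_pos _)
    (Real.sin_pos_of_pos_of_lt_pi (contourArg_pos hγ hu) (contourArg_mem hγ u).2)

lemma logPath_neg (hγ : 0 < γ) (u : ℝ) : logPath γ (-u) = star (logPath γ u) := by
  rw [logPath, logPath, contourArg_neg hγ, contourRe_neg]
  simp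

lemma exp_logPath_im_neg (hγ : 0 < γ) (hu : u < 0) : (Complex.exp (logPath γ u)).im < 0 := by
  have h := exp_logPath_im_pos hγ (neg_pos.2 hu)
  rw [logPath_neg hγ, Complex.star_def, Complex.exp_conj, Complex.conj_im] at h
  linarith

lemma logPath_zero (hγ : 0 < γ) : logPath γ 0 = (γ : ℂ) := by
  simp [logPath, contourArg_zero hγ, contourRe_zero]

lemma cpow_half_sq (z : ℂ) : (z ^ (1 / 2 : ℂ)) ^ 2 = z := by
  have := Complex.cpow_nat_inv_pow z (n := 2) two_ne_zero
  rwa [Nat.cast_ofNat, ← one_div] at this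

lemma sq_cpow_half (u : ℝ) : (((u ^ 2 : ℝ) : ℂ)) ^ (1 / 2 : ℂ) = (|u| : ℝ) := by
  rw [show (1 / 2 : ℂ) = ((1 / 2 : ℝ) : ℂ) by norm_num, ← Complex.ofReal_cpow (sq_nonneg u),
    ← Real.sqrt_eq_rpow, Real.sqrt_sq_eq_abs]

lemma sign_mul_abs_eq_iff {v : ℝ} (hu : u ≠ 0) :
    Real.sign v * |u| = u ↔ (0 < u ∧ 0 < v) ∨ (u < 0 ∧ v < 0) := by
  rcases lt_or_gt_of_ne hu with h | h <;> rcases lt_trichotomy v 0 with hv | rfl | hv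
  · simp [Real.sign_of_neg hv, abs_of_neg h, h, hv]
  · simp [hu.symm]
  · simp only [Real.sign_of_pos hv, abs_of_neg h, one_mul]
    constructor
    · intro; linarith
    · rintro (⟨_, _⟩ | ⟨_, _⟩) <;> linarith
  · simp only [Real.sign_of_neg hv, abs_of_pos h]
    constructor
    · intro; linarith
    · rintro (⟨_, _⟩ | ⟨_, _⟩) <;> linarith
  · simp [hu.symm]
  · simp [Real.sign_of_pos hv, abs_of_pos h, h, hv]

lemma tInv_eq_iff_alpha {x : ℂ} (hu : u ≠ 0) :
    tInv γ x = u ↔ 2 * alpha γ (Complex.log x) = ((u ^ 2 : ℝ) : ℂ) ∧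
      ((0 < u ∧ 0 < x.im) ∨ (u < 0 ∧ x.im < 0)) := by
  rw [← sign_mul_abs_eq_iff hu, tInv]
  constructor
  · intro h
    -- A vanishing sign would give `u = 0`; otherwise squaring removes both the sign and the choice
    -- of root.
    have hσ : ((Real.sign x.im : ℝ) : ℂ) ^ 2 = 1 := by
      rcases Real.sign_apply_eq x.im with h' | h' | h'
      · simp [h']
      · rw [h'] at h
        exact absurd (by simpa using h.symm) hu
      · simp [h']
    have h2 : 2 * alpha γ (Complex.log x) = ((u ^ 2 : ℝ) : ℂ) := by
      have h3 := congrArg (· ^ 2) h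
      simp only [mul_pow, hσ, one_mul, cpow_half_sq] at h3
      rw [h3]; push_cast; rfl
    refine ⟨h2, ?_⟩
    rw [h2, sq_cpow_half] at h
    exact_mod_cast h
  · rintro ⟨h1, h2⟩
    rw [h1, sq_cpow_half]
    exact_mod_cast h2

lemma log_exp_logPath (hγ : 0 < γ) (u : ℝ) :
    Complex.log (Complex.exp (logPath γ u)) = logPath γ u := by
  have h := contourArg_mem hγ u
  apply Complex.log_exp <;> simp [logPath]
  · exact h.1
  · exact h.2.le

/-- The sign condition makes `x` nonreal, so `arg x` avoids `0` and `π`. The imaginary part of the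
equation then places `log x` on the curve, and the real part with the sign fixes the parameter as
`u`. -/
theorem tInv_eq_iff {x : ℂ} (hγ : 0 < γ) (hu : u ≠ 0) :
    tInv γ x = u ↔ x = Complex.exp (logPath γ u) := by
  rw [tInv_eq_iff_alpha hu]
  constructor
  · rintro ⟨h, hs⟩
    have him : x.im ≠ 0 := by rcases hs with hs | hs <;> [exact hs.2.ne'; exact hs.2.ne]
    have hx0 : x ≠ 0 := by rintro rfl; simp at him
    set b := x.arg with hbdef
    have hlog : Complex.log x = ((Real.log ‖x‖ : ℝ) : ℂ) + (b : ℂ) * Complex.I := rfl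
    have hmem : b ∈ Ioo (-Real.pi) Real.pi :=
      ⟨Complex.neg_pi_lt_arg x, lt_of_le_of_ne (Complex.arg_le_pi x)
        fun h => him (Complex.arg_eq_pi_iff.1 h).2⟩
    have hb0 : b ≠ 0 := fun h => him (Complex.arg_eq_zero_iff.1 h).2
    rw [hlog, alpha_add_mul_I] at h
    obtain ⟨hre, him'⟩ := two_mul_add_mul_I_eq_ofReal h
    have hA := contourRe_eq_of_sinh_mul_sin (γ := γ) hmem hb0
      (a := Real.log ‖x‖) (by linarith)
    have hR : 2 * contourHeight γ b = u ^ 2 := by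
      rw [contourHeight, ← hA, ← hre]
    rw [← contourParam_sq hmem] at hR
    have hU : contourParam γ b = u := by
      rcases hs with ⟨h1, h2⟩ | ⟨h1, h2⟩
      · have hb : 0 < b := lt_of_le_of_ne (Complex.arg_nonneg_iff.2 h2.le) hb0.symm
        exact (pow_left_inj₀ (contourParam_pos hb hmem.2).le h1.le two_ne_zero).1 hR
      · have hb : b < 0 := Complex.arg_neg_iff.2 h2
        have h3 := contourParam_pos (γ := γ) (neg_pos.2 hb) (by linarith [hmem.1])
        rw [contourParam_neg] at h3
        have := (pow_left_inj₀ h3.le (neg_pos.2 h1).le two_ne_zero).1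
          (by rw [neg_sq, neg_sq]; exact hR)
        linarith
    rw [logPath, contourArg_eq hγ hmem hU, ← hA, ← hlog, Complex.exp_log hx0]
  · rintro rfl
    rw [log_exp_logPath hγ, alpha_logPath hγ]
    refine ⟨by push_cast; ring, ?_⟩
    rcases lt_or_gt_of_ne hu with h | h
    · exact Or.inr ⟨h, exp_logPath_im_neg hγ h⟩
    · exact Or.inl ⟨h, exp_logPath_im_pos hγ h⟩

theorem existsUnique_tInv_eq (hγ : 0 < γ) (hu : u ≠ 0) : ∃! x : ℂ, tInv γ x = (u : ℂ) :=
  ⟨_, (tInv_eq_iff hγ hu).2 rfl, fun _ h => (tInv_eq_iff hγ hu).1 h⟩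

theorem t_eq_exp_logPath (hγ : 0 < γ) (u : ℝ) : t γ u = Complex.exp (logPath γ u) := by
  rcases eq_or_ne u 0 with rfl | hu
  · simp [t, logPath_zero hγ]
  · have h := (existsUnique_tInv_eq hγ hu).exists
    rw [t, if_neg hu, dif_pos h]
    exact (tInv_eq_iff hγ hu).1 h.choose_spec

/-! ### Analyticity, symmetry and derivative of `t`. -/

lemma analyticAt_logPath (hγ : 0 < γ) (u : ℝ) : AnalyticAt ℝ (logPath γ) u := by
  have h1 := analyticAt_contourArg hγ u
  have h2 : AnalyticAt ℝ (fun u => contourRe γ (contourArg γ u)) u :=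
    (analyticAt_contourRe (contourArg_mem hγ u)).comp h1
  have key : ∀ {φ : ℝ → ℝ}, AnalyticAt ℝ φ u → AnalyticAt ℝ (fun u => (φ u : ℂ)) u :=
    fun hφ => (Complex.ofRealCLM.analyticAt _).comp hφ
  exact (key h2).add ((key h1).mul analyticAt_const)

lemma analyticAt_t (hγ : 0 < γ) (u : ℝ) : AnalyticAt ℝ (t γ) u := by
  have h : t γ = fun u => Complex.exp (logPath γ u) := funext (t_eq_exp_logPath hγ)
  rw [h]
  have := (analyticAt_logPath hγ u).contDiffAt (n := ⊤)
  exact this.cexp.analyticAt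

lemma t_neg (hγ : 0 < γ) (u : ℝ) : t γ (-u) = star (t γ u) := by
  rw [t_eq_exp_logPath hγ, t_eq_exp_logPath hγ, logPath_neg hγ, Complex.star_def,
    Complex.exp_conj]

/-- This is the derivative of `alpha γ (logPath γ u) = u² / 2`. -/
lemma deriv_logPath (hγ : 0 < γ) (u : ℝ) :
    deriv (logPath γ) u * ((Real.sinh γ : ℂ) - Complex.sinh (logPath γ u)) = u := by
  have hw := (analyticAt_logPath hγ u).differentiableAt.hasDerivAt
  have ha : HasDerivAt (alpha γ) (0 - Complex.sinh (logPath γ u) + (Real.sinh γ : ℂ) * (1 - 0))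
      (logPath γ u) :=
    ((hasDerivAt_const _ _).sub (Complex.hasDerivAt_cosh _)).add
      (((hasDerivAt_id _).sub (hasDerivAt_const _ _)).const_mul _)
  have h1 := HasDerivAt.scomp u ha hw
  have h2 : HasDerivAt (alpha γ ∘ logPath γ) (((2 * u / 2 : ℝ)) : ℂ) u := by
    have h3 : HasDerivAt (fun u : ℝ => u ^ 2 / 2) (2 * u / 2) u := by
      simpa using (hasDerivAt_pow 2 u).div_const 2
    refine h3.ofReal_comp.congr_of_eventuallyEq (Eventually.of_forall fun x => ?_)
    exact alpha_logPath hγ x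
  have h3 := h1.unique h2
  rw [smul_eq_mul] at h3
  simp only [mul_div_cancel_left₀ _ (two_ne_zero (α := ℝ))] at h3
  rw [← h3]; ring

lemma deriv_t (hγ : 0 < γ) (u : ℝ) : deriv (t γ) u = t γ u * deriv (logPath γ) u := by
  have h : t γ = fun u => Complex.exp (logPath γ u) := funext (t_eq_exp_logPath hγ)
  rw [h]
  exact (analyticAt_logPath hγ u).differentiableAt.hasDerivAt.cexp.deriv

/-! ### Analyticity, Taylor coefficients and growth of `f`. -/

variable {Ω : ℝ} {e : ErrorKind}

/-- The path is nonreal except at `u = 0`, where it equals `exp γ`; so `θ ≠ γ` excludes the only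
possible pole. -/
lemma exp_theta_sub_t_ne_zero (hγ : 0 < γ) (hθ : theta Ω e γ ≠ γ) (u : ℝ) :
    (Real.exp (theta Ω e γ) : ℂ) - t γ u ≠ 0 := by
  rw [t_eq_exp_logPath hγ, sub_ne_zero]
  intro h
  rcases lt_trichotomy u 0 with hu | rfl | hu
  · have := exp_logPath_im_neg hγ hu
    rw [← h, Complex.ofReal_im] at this
    exact this.ne rfl
  · rw [logPath_zero hγ, ← Complex.ofReal_exp, Complex.ofReal_inj, Real.exp_eq_exp] at h
    exact hθ h
  · have := exp_logPath_im_pos hγ hu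
    rw [← h, Complex.ofReal_im] at this
    exact this.ne rfl

lemma analyticAt_f (hγ : 0 < γ) (hθ : theta Ω e γ ≠ γ) (u : ℝ) : AnalyticAt ℝ (f Ω e γ) u :=
  (analyticAt_t hγ u).deriv.fun_div (analyticAt_const.sub (analyticAt_t hγ u))
    (exp_theta_sub_t_ne_zero hγ hθ u)

lemma f_neg (hγ : 0 < γ) (u : ℝ) : f Ω e γ (-u) = -star (f Ω e γ u) := by
  have h : deriv (t γ) (-u) = -star (deriv (t γ) u) := by
    have h1 := deriv_comp_neg (t γ) u
    simp only [t_neg hγ, deriv.star] at h1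
    rw [h1, neg_neg]
  rw [f, f, h, t_neg hγ]
  simp [neg_div, ← Complex.exp_conj]

lemma iteratedDeriv_star {F : ℝ → ℂ} (k : ℕ) :
    iteratedDeriv k (fun u => star (F u)) = fun u => star (iteratedDeriv k F u) := by
  induction k with
  | zero => simp
  | succ k ih =>
    ext u
    rw [iteratedDeriv_succ, ih, iteratedDeriv_succ, deriv.star]

lemma iteratedDeriv_f_zero (hγ : 0 < γ) (k : ℕ) :
    (-1 : ℂ) ^ k * iteratedDeriv k (f Ω e γ) 0 = -star (iteratedDeriv k (f Ω e γ) 0) := by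
  have h := iteratedDeriv_comp_neg k (f Ω e γ) 0
  simp only [f_neg hγ] at h
  rw [iteratedDeriv_fun_neg, iteratedDeriv_star, neg_zero] at h
  rw [h]
  simp

lemma c_mul_I (k : ℕ) :
    Complex.I * c Ω e γ k = iteratedDeriv k (f Ω e γ) 0 / (k.factorial : ℂ) := by
  rw [c, ← mul_assoc]; simp

lemma c_even_im (hγ : 0 < γ) (k : ℕ) : (c Ω e γ (2 * k)).im = 0 := by
  have h := congrArg Complex.re (iteratedDeriv_f_zero (Ω := Ω) (e := e) hγ (2 * k))
  simp [pow_mul] at h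
  have h2 : (iteratedDeriv (2 * k) (f Ω e γ) 0).re = 0 := by linarith
  rw [c, ← Complex.ofReal_natCast]
  simp [Complex.div_re, h2]

lemma c_odd_re (hγ : 0 < γ) (k : ℕ) : (c Ω e γ (2 * k + 1)).re = 0 := by
  have h := congrArg Complex.im (iteratedDeriv_f_zero (Ω := Ω) (e := e) hγ (2 * k + 1))
  simp [pow_mul, pow_succ] at h
  have h2 : (iteratedDeriv (2 * k + 1) (f Ω e γ) 0).im = 0 := by linarith
  rw [c, ← Complex.ofReal_natCast]
  simp [Complex.div_im, h2]

lemma exists_hasFPowerSeriesAt_f (hγ : 0 < γ) (hθ : theta Ω e γ ≠ γ) :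
    ∃ p : FormalMultilinearSeries ℝ ℝ ℂ, HasFPowerSeriesAt (f Ω e γ) p 0 ∧
      ∀ k, p.coeff k = Complex.I * c Ω e γ k := by
  obtain ⟨p, r, hp⟩ := analyticAt_f hγ hθ 0
  refine ⟨p, hp.hasFPowerSeriesAt, fun k => ?_⟩
  have h := hp.factorial_smul 1 k
  rw [c_mul_I, iteratedDeriv_eq_iteratedFDeriv, ← h,
    eq_div_iff (Nat.cast_ne_zero.2 k.factorial_ne_zero), nsmul_eq_mul, mul_comm]
  rfl

lemma eventually_hasSum_f (hγ : 0 < γ) (hθ : theta Ω e γ ≠ γ) :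
    ∀ᶠ u : ℝ in 𝓝 0, HasSum (fun k : ℕ => Complex.I * (c Ω e γ k * (u : ℂ) ^ k)) (f Ω e γ u) := by
  obtain ⟨p, hp, hc⟩ := exists_hasFPowerSeriesAt_f hγ hθ
  filter_upwards [hasFPowerSeriesAt_iff.1 hp] with u hu
  simp only [zero_add, hc, Complex.real_smul] at hu
  have hterm : (fun k : ℕ => Complex.I * (c Ω e γ k * (u : ℂ) ^ k)) =
      fun k => ((u ^ k : ℝ) : ℂ) * (Complex.I * c Ω e γ k) := by
    funext k
    push_cast
    ring
  rw [hterm]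
  exact hu

/-- The Taylor term `i c_k u^k` has imaginary part `Re c_k · u^k`, which vanishes for odd `k`. The
partial sum below degree `2K` therefore reduces to `K` even terms. -/
lemma f_im_sub_sum_isBigO (hγ : 0 < γ) (hθ : theta Ω e γ ≠ γ) (K : ℕ) :
    (fun u : ℝ => (f Ω e γ u).im - ∑ k ∈ Finset.range K, (c Ω e γ (2 * k)).re * u ^ (2 * k))
      =O[𝓝 0] fun u : ℝ => u ^ (2 * K) := by
  obtain ⟨p, hp, hc⟩ := exists_hasFPowerSeriesAt_f hγ hθ
  have h := hp.isBigO_sub_partialSum_pow (2 * K)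
  refine (IsBigO.of_norm_right (IsBigO.trans (IsBigO.of_bound 1 (Eventually.of_forall ?_))
    (h.congr_right (fun u => by rw [norm_pow]))))
  intro u
  have key : (p.partialSum (2 * K) u).im
      = ∑ k ∈ Finset.range K, (c Ω e γ (2 * k)).re * u ^ (2 * k) := by
    have hterm : ∀ k, (p k (fun _ => u)).im = (c Ω e γ k).re * u ^ k := by
      intro k
      rw [FormalMultilinearSeries.apply_eq_pow_smul_coeff, hc, Complex.real_smul,
        Complex.im_ofReal_mul]
      simp [mul_comm]
    rw [FormalMultilinearSeries.partialSum, Complex.im_sum, Finset.sum_congr rfl fun k _ => hterm k]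
    clear h
    induction K with
    | zero => simp
    | succ K ih =>
      rw [show 2 * (K + 1) = 2 * K + 1 + 1 by ring, Finset.sum_range_succ, Finset.sum_range_succ,
        ih, Finset.sum_range_succ, c_odd_re hγ]
      simp
  rw [← key, zero_add, ← Complex.sub_im, one_mul]
  exact Complex.abs_im_le_norm _

/-- The margin `log 2` gives `|exp θ - t| ≥ |t| / 2`. Since `t' = t · logPath'`, the factor `|t|`
cancels and only the bound `|logPath'| ≤ u / sinh γ` remains. -/
lemma norm_f_le {b₀ : ℝ} (hγ : 0 < γ) (hb₀ : b₀ ∈ Ico (Real.pi / 2) Real.pi)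
    (h : ∀ b ∈ Ico b₀ Real.pi, theta Ω e γ + Real.log 2 ≤ contourRe γ b)
    (hu : contourParam γ b₀ ≤ u) : ‖f Ω e γ u‖ ≤ 2 / Real.sinh γ * u := by
  have hs := Real.sinh_pos_iff.2 hγ
  have hpi := Real.pi_gt_three
  have hmem := contourArg_mem hγ u
  have hmem₀ : b₀ ∈ Ioo (-Real.pi) Real.pi := ⟨by linarith [hb₀.1], hb₀.2⟩
  have hb : b₀ ≤ contourArg γ u := by
    rwa [← contourParam_contourArg hγ u,
      strictMonoOn_contourParam.le_iff_le hmem₀ hmem] at hu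
  have hu0 : 0 < u := (contourParam_pos (by linarith [hb₀.1]) hb₀.2).trans_le hu
  have hA := h _ ⟨hb, hmem.2⟩
  have hsin := Real.sin_pos_of_pos_of_lt_pi (contourArg_pos hγ hu0) hmem.2
  set a := contourRe γ (contourArg γ u) with ha
  have hre : (logPath γ u).re = a := by simp [logPath, ha]
  -- The imaginary part suffices: `cosh a sin b ≥ sinh a sin b = sinh γ · b ≥ sinh γ`, as `b ≥ π / 2
  -- > 1`.
  have h1 : Real.sinh γ ≤ ‖(Real.sinh γ : ℂ) - Complex.sinh (logPath γ u)‖ := by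
    refine le_trans ?_ (Complex.abs_im_le_norm _)
    have : ((Real.sinh γ : ℂ) - Complex.sinh (logPath γ u)).im
        = -(Real.cosh a * Real.sin (contourArg γ u)) := by
      rw [Complex.sub_im, Complex.ofReal_im, logPath, Complex.sinh_add, Complex.sinh_mul_I,
        Complex.cosh_mul_I, ← Complex.ofReal_sinh, ← Complex.ofReal_cosh, ← Complex.ofReal_sin,
        ← Complex.ofReal_cos]
      simp [-Complex.ofReal_sinh, -Complex.ofReal_cosh, -Complex.ofReal_sin, -Complex.ofReal_cos,
        ← ha]
    rw [this, abs_neg]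
    refine le_trans ?_ (le_abs_self _)
    have h2 := sinh_contourRe_mul_sin (γ := γ) hmem
    have h3 := Real.sinh_lt_cosh a
    have hb1 : 1 ≤ contourArg γ u := by linarith [hb₀.1]
    rw [← ha] at h2
    nlinarith
  have h2 : ‖deriv (logPath γ) u‖ ≤ u / Real.sinh γ := by
    rw [le_div_iff₀ hs]
    have h3 := congrArg norm (deriv_logPath hγ u)
    rw [norm_mul, Complex.norm_real, Real.norm_of_nonneg hu0.le] at h3
    exact (mul_le_mul_of_nonneg_left h1 (norm_nonneg _)).trans h3.le
  have h3 : ‖t γ u‖ = Real.exp a := by rw [t_eq_exp_logPath hγ, Complex.norm_exp, hre]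
  have h4 : Real.exp a / 2 ≤ ‖(Real.exp (theta Ω e γ) : ℂ) - t γ u‖ := by
    have h5 := norm_sub_norm_le (t γ u) (Real.exp (theta Ω e γ) : ℂ)
    rw [norm_sub_rev, h3, Complex.norm_real, Real.norm_of_nonneg (Real.exp_pos _).le] at h5
    have h6 : Real.exp (theta Ω e γ) * 2 ≤ Real.exp a := by
      have h7 := Real.exp_le_exp.2 hA
      rwa [Real.exp_add, Real.exp_log two_pos] at h7
    linarith
  have hpos : 0 < Real.exp a / 2 := by positivity
  rw [f, deriv_t hγ, norm_div, norm_mul, h3, div_le_iff₀ (hpos.trans_le h4)]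
  calc Real.exp a * ‖deriv (logPath γ) u‖ ≤ Real.exp a * (u / Real.sinh γ) := by gcongr
    _ = 2 / Real.sinh γ * u * (Real.exp a / 2) := by field_simp
    _ ≤ _ := by gcongr

lemma f_im_isBigO_atTop (hγ : 0 < γ) :
    (fun u => (f Ω e γ u).im) =O[atTop] (fun u : ℝ => u) := by
  obtain ⟨b₀, hb₀, h⟩ := exists_forall_le_contourRe hγ (theta Ω e γ + Real.log 2)
  refine IsBigO.of_bound (2 / Real.sinh γ) ?_
  filter_upwards [eventually_ge_atTop (contourParam γ b₀), eventually_ge_atTop 0] with u hu hu0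
  rw [Real.norm_of_nonneg hu0]
  exact (Complex.abs_im_le_norm _).trans (norm_f_le hγ hb₀ h hu)

lemma continuous_f_im (hγ : 0 < γ) (hθ : theta Ω e γ ≠ γ) :
    Continuous fun u => (f Ω e γ u).im :=
  Complex.continuous_im.comp
    (continuous_iff_continuousAt.2 fun u => (analyticAt_f hγ hθ u).continuousAt)

/-! ### Gaussian moments and Watson's lemma. -/

section Watson

variable {σ n : ℝ}

lemma neg_div_mul_sq (n σ u : ℝ) : -(n * u ^ 2 / σ) = -(n / σ) * u ^ 2 := by ring

lemma integrableOn_pow_mul_gaussian (hσ : 0 < σ) (hn : 0 < n) (m : ℕ) :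
    IntegrableOn (fun u : ℝ => u ^ m * Real.exp (-(n * u ^ 2 / σ))) (Ioi 0) := by
  have h := integrableOn_rpow_mul_exp_neg_mul_sq (div_pos hn hσ) (s := m)
    (by have := m.cast_nonneg (α := ℝ); linarith)
  simpa only [Real.rpow_natCast, neg_div_mul_sq] using h

lemma integral_pow_mul_gaussian (hσ : 0 < σ) (hn : 0 < n) (m : ℕ) :
    ∫ u in Ioi (0 : ℝ), u ^ m * Real.exp (-(n * u ^ 2 / σ)) =
      (σ / n) ^ (((m : ℝ) + 1) / 2) * (1 / 2) * Real.Gamma (((m : ℝ) + 1) / 2) := by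
  have h := integral_rpow_mul_exp_neg_mul_rpow two_pos (q := m)
    (by have := m.cast_nonneg (α := ℝ); linarith) (div_pos hn hσ)
  simp only [Real.rpow_natCast, Real.rpow_two] at h
  simp only [neg_div_mul_sq]
  rw [h, neg_div, Real.rpow_neg (div_pos hn hσ).le, ← Real.inv_rpow (div_pos hn hσ).le, inv_div]

/-- The lower power controls `r` near `0` and the higher one near infinity; on the compact range
between, `r` is bounded and `u ^ m ≥ δ ^ m`. -/
lemma exists_remainder_bound {r : ℝ → ℝ} (hr : Continuous r) {m : ℕ}
    (h0 : r =O[𝓝 0] fun u : ℝ => u ^ m) (hinf : r =O[atTop] fun u : ℝ => u ^ (m + 1)) :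
    ∃ C, 0 ≤ C ∧ ∀ u : ℝ, 0 < u → |r u| ≤ C * (u ^ m + u ^ (m + 1)) := by
  obtain ⟨C₁, hC₁, h1⟩ := h0.exists_nonneg
  obtain ⟨C₂, hC₂, h2⟩ := hinf.exists_nonneg
  obtain ⟨δ, hδ, h1⟩ := Metric.eventually_nhds_iff.1 h1.bound
  obtain ⟨N, h2⟩ := eventually_atTop.1 h2.bound
  obtain ⟨C₃, h3⟩ := isCompact_Icc.exists_bound_of_continuousOn (hr.continuousOn (s := Icc 0 N))
  have h3' : 0 ≤ max C₃ 0 / δ ^ m := by positivity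
  refine ⟨C₁ + C₂ + max C₃ 0 / δ ^ m, by positivity, fun u hu => ?_⟩
  have p1 : 0 < u ^ m := by positivity
  have p2 : 0 < u ^ (m + 1) := by positivity
  rcases lt_or_ge u δ with hu1 | hu1
  · have := h1 (y := u) (by rwa [Real.dist_eq, sub_zero, abs_of_pos hu])
    rw [Real.norm_of_nonneg p1.le, Real.norm_eq_abs] at this
    refine this.trans ?_
    gcongr <;> linarith
  · rcases le_or_gt N u with hu2 | hu2
    · have := h2 u hu2
      rw [Real.norm_of_nonneg p2.le, Real.norm_eq_abs] at this
      refine this.trans ?_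
      gcongr <;> linarith
    · have := h3 u ⟨hu.le, hu2.le⟩
      rw [Real.norm_eq_abs] at this
      have h4 : max C₃ 0 ≤ max C₃ 0 / δ ^ m * u ^ m := by
        rw [div_mul_eq_mul_div, le_div_iff₀ (by positivity)]
        gcongr
      refine (this.trans (le_max_left _ 0)).trans (h4.trans ?_)
      gcongr <;> linarith

lemma integrableOn_mul_gaussian_of_bound {r : ℝ → ℝ} (hr : Continuous r) {m : ℕ} {C : ℝ}
    (h : ∀ u : ℝ, 0 < u → |r u| ≤ C * (u ^ m + u ^ (m + 1))) (hσ : 0 < σ) (hn : 0 < n) :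
    IntegrableOn (fun u => r u * Real.exp (-(n * u ^ 2 / σ))) (Ioi 0) := by
  have hI := ((integrableOn_pow_mul_gaussian hσ hn m).add
    (integrableOn_pow_mul_gaussian hσ hn (m + 1))).const_mul C
  refine Integrable.mono' hI (by fun_prop) ?_
  filter_upwards [self_mem_ae_restrict measurableSet_Ioi] with u hu
  rw [norm_mul, Real.norm_of_nonneg (Real.exp_pos _).le, Real.norm_eq_abs]
  calc |r u| * Real.exp (-(n * u ^ 2 / σ))
      ≤ C * (u ^ m + u ^ (m + 1)) * Real.exp (-(n * u ^ 2 / σ)) := by gcongr; exact h u hu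
    _ = _ := by simp only [Pi.add_apply]; ring

lemma abs_integral_mul_gaussian_le {r : ℝ → ℝ} {K : ℕ} {C : ℝ} (hC : 0 ≤ C)
    (h : ∀ u : ℝ, 0 < u → |r u| ≤ C * (u ^ (2 * K) + u ^ (2 * K + 1))) (hσ : 0 < σ)
    (hn : 1 ≤ n) :
    |∫ u in Ioi (0 : ℝ), r u * Real.exp (-(n * u ^ 2 / σ))| ≤
      C * (σ ^ ((K : ℝ) + 1 / 2) * (1 / 2) * Real.Gamma ((K : ℝ) + 1 / 2) +
        σ ^ ((K : ℝ) + 1) * (1 / 2) * Real.Gamma ((K : ℝ) + 1)) * n ^ (-(K : ℝ) - 1 / 2) := by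
  have hn0 : 0 < n := by linarith
  have hI1 := integrableOn_pow_mul_gaussian hσ hn0 (2 * K)
  have hI2 := integrableOn_pow_mul_gaussian hσ hn0 (2 * K + 1)
  have h1 : |∫ u in Ioi (0 : ℝ), r u * Real.exp (-(n * u ^ 2 / σ))| ≤
      ∫ u in Ioi (0 : ℝ), C * (u ^ (2 * K) * Real.exp (-(n * u ^ 2 / σ)) +
        u ^ (2 * K + 1) * Real.exp (-(n * u ^ 2 / σ))) := by
    rw [← Real.norm_eq_abs]
    refine norm_integral_le_of_norm_le ((hI1.add hI2).const_mul C) ?_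
    filter_upwards [self_mem_ae_restrict measurableSet_Ioi] with u hu
    rw [norm_mul, Real.norm_of_nonneg (Real.exp_pos _).le, Real.norm_eq_abs, ← add_mul, ← mul_assoc]
    gcongr
    exact h u hu
  rw [integral_const_mul, integral_add hI1 hI2, integral_pow_mul_gaussian hσ hn0,
    integral_pow_mul_gaussian hσ hn0] at h1
  have e1 : (((2 * K : ℕ) : ℝ) + 1) / 2 = (K : ℝ) + 1 / 2 := by push_cast; ring
  have e2 : (((2 * K + 1 : ℕ) : ℝ) + 1) / 2 = (K : ℝ) + 1 := by push_cast; ring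
  rw [e1, e2] at h1
  have s1 : (σ / n) ^ ((K : ℝ) + 1 / 2) = σ ^ ((K : ℝ) + 1 / 2) * n ^ (-(K : ℝ) - 1 / 2) := by
    rw [Real.div_rpow hσ.le hn0.le, div_eq_mul_inv, ← Real.rpow_neg hn0.le, neg_add']
  -- The higher moment decays by an extra factor `n ^ (-1/2)`, at most `1` because `n ≥ 1`.
  have s2 : (σ / n) ^ ((K : ℝ) + 1) ≤ σ ^ ((K : ℝ) + 1) * n ^ (-(K : ℝ) - 1 / 2) := by
    rw [Real.div_rpow hσ.le hn0.le, div_eq_mul_inv, ← Real.rpow_neg hn0.le]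
    gcongr
    linarith
  have g2 : 0 < Real.Gamma ((K : ℝ) + 1) := Real.Gamma_pos_of_pos (by positivity)
  refine h1.trans ?_
  rw [mul_assoc C, add_mul, s1]
  refine mul_le_mul_of_nonneg_left (add_le_add (le_of_eq (by ring)) ?_) hC
  calc (σ / n) ^ ((K : ℝ) + 1) * (1 / 2) * Real.Gamma ((K : ℝ) + 1)
      ≤ (σ ^ ((K : ℝ) + 1) * n ^ (-(K : ℝ) - 1 / 2)) * (1 / 2) * Real.Gamma ((K : ℝ) + 1) := by
        gcongr
    _ = _ := by ring

/-- **Watson's lemma** for Gaussian integrals of a continuous function of linear growth whose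
expansion at `0` has only even powers, uniformly in `n ≥ 1`. -/
theorem watson_gaussian {h : ℝ → ℝ} (hh : Continuous h) (hinf : h =O[atTop] fun u : ℝ => u)
    (a : ℕ → ℝ) (K : ℕ)
    (h0 : (fun u => h u - ∑ k ∈ Finset.range K, a k * u ^ (2 * k)) =O[𝓝 0]
      fun u : ℝ => u ^ (2 * K)) (hσ : 0 < σ) :
    ∃ C : ℝ, ∀ n : ℝ, 1 ≤ n →
      IntegrableOn (fun u => h u * Real.exp (-(n * u ^ 2 / σ))) (Ioi 0) ∧
      |(∫ u in Ioi (0 : ℝ), h u * Real.exp (-(n * u ^ 2 / σ))) -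
        ∑ k ∈ Finset.range K, a k * ((σ / n) ^ ((k : ℝ) + 1 / 2) * (1 / 2) *
          Real.Gamma ((k : ℝ) + 1 / 2))| ≤ C * n ^ (-(K : ℝ) - 1 / 2) := by
  set r : ℝ → ℝ := fun u => h u - ∑ k ∈ Finset.range K, a k * u ^ (2 * k) with hr
  have hrc : Continuous r := by fun_prop
  have hpow : ∀ {i j : ℕ}, i ≤ j → (fun u : ℝ => u ^ i) =O[atTop] fun u : ℝ => u ^ j := by
    intro i j hij
    refine IsBigO.of_bound 1 ?_
    filter_upwards [eventually_ge_atTop 1] with u hu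
    rw [norm_pow, norm_pow, Real.norm_of_nonneg (by linarith : (0:ℝ) ≤ u), one_mul]
    gcongr
  -- The exponent `2K + 1` dominates both the linear growth of `h`, even for `K = 0`, and the
  -- subtracted polynomial.
  have hrinf : r =O[atTop] fun u : ℝ => u ^ (2 * K + 1) := by
    refine (hinf.trans ?_).sub (IsBigO.fun_sum fun k hk => ?_)
    · simpa using hpow (i := 1) (j := 2 * K + 1) (by omega)
    · exact (hpow (by have := Finset.mem_range.1 hk; omega)).const_mul_left _
  obtain ⟨C, hC, hb⟩ := exists_remainder_bound hrc h0 hrinf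
  refine ⟨C * (σ ^ ((K : ℝ) + 1 / 2) * (1 / 2) * Real.Gamma ((K : ℝ) + 1 / 2) +
    σ ^ ((K : ℝ) + 1) * (1 / 2) * Real.Gamma ((K : ℝ) + 1)), fun n hn => ?_⟩
  have hn0 : 0 < n := by linarith
  have hIr := integrableOn_mul_gaussian_of_bound hrc hb hσ hn0
  have hIk : ∀ k ∈ Finset.range K, IntegrableOn
      (fun u => a k * (u ^ (2 * k) * Real.exp (-(n * u ^ 2 / σ)))) (Ioi 0) :=
    fun k _ => (integrableOn_pow_mul_gaussian hσ hn0 (2 * k)).const_mul (a k)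
  have hIs := integrable_finsetSum _ hIk
  have heq : (fun u => h u * Real.exp (-(n * u ^ 2 / σ))) = fun u =>
      r u * Real.exp (-(n * u ^ 2 / σ)) +
        ∑ k ∈ Finset.range K, a k * (u ^ (2 * k) * Real.exp (-(n * u ^ 2 / σ))) := by
    ext u
    simp only [hr, ← mul_assoc, ← Finset.sum_mul]
    ring
  refine ⟨by rw [heq]; exact hIr.add hIs, ?_⟩
  rw [heq, integral_add hIr hIs, integral_finsetSum _ hIk]
  have hk : ∀ k : ℕ, ∫ u in Ioi (0 : ℝ), a k * (u ^ (2 * k) * Real.exp (-(n * u ^ 2 / σ)))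
      = a k * ((σ / n) ^ ((k : ℝ) + 1 / 2) * (1 / 2) * Real.Gamma ((k : ℝ) + 1 / 2)) := by
    intro k
    rw [integral_const_mul, integral_pow_mul_gaussian hσ hn0,
      show (((2 * k : ℕ) : ℝ) + 1) / 2 = (k : ℝ) + 1 / 2 by push_cast; ring]
  simp only [hk, add_sub_cancel_right]
  exact abs_integral_mul_gaussian_le hC hb hσ hn

end Watson

end

end AWGNConverse

theorem theorem5 (Ω γ : ℝ) (hΩ : 0 < Ω) (hγ : 0 < γ) (e : AWGNConverse.ErrorKind)
    (hθ : AWGNConverse.theta Ω e γ ≠ γ) :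
    -- `t` is well defined by its inverse relation and is differentiable
    (∀ u : ℝ, u ≠ 0 → ∃! x : ℂ, AWGNConverse.tInv γ x = (u : ℂ)) ∧
    Differentiable ℝ (AWGNConverse.t γ) ∧
    -- `f` is the sum of its Taylor series `i ∑ c_k u^k` near `0`, and the `c_{2k}` are real
    (∀ᶠ u : ℝ in nhds 0,
      HasSum (fun k : ℕ => Complex.I * (AWGNConverse.c Ω e γ k * (u : ℂ) ^ k))
        (AWGNConverse.f Ω e γ u)) ∧
    (∀ k : ℕ, (AWGNConverse.c Ω e γ (2 * k)).im = 0) ∧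
    -- the integral that defines `g` converges
    (∀ n : ℝ, 1 ≤ n →
      MeasureTheory.IntegrableOn (AWGNConverse.gIntegrand Ω e γ n) (Set.Ioi 0)) ∧
    -- the expansion, with a remainder bound after `K` terms that is uniform in `n ∈ [1, ∞)`
    (∀ K : ℕ, ∃ C : ℝ, ∀ n : ℝ, 1 ≤ n →
      |AWGNConverse.g Ω e γ n -
          1 / (2 * Real.sqrt Real.pi) *
            ∑ k ∈ Finset.range K,
              (AWGNConverse.c Ω e γ (2 * k)).re *
                (Real.Gamma ((k : ℝ) + 1 / 2) / Real.Gamma (1 / 2)) *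
                (4 * Real.sinh γ / n) ^ ((k : ℝ) + 1 / 2)|
        ≤ C * n ^ (-(K : ℝ) - 1 / 2)) := by
  open AWGNConverse in
  have hσ : 0 < 4 * Real.sinh γ := by linarith [Real.sinh_pos_iff.2 hγ]
  have hw := fun K => watson_gaussian (continuous_f_im hγ hθ) (f_im_isBigO_atTop hγ)
    (fun k => (c Ω e γ (2 * k)).re) K (f_im_sub_sum_isBigO hγ hθ K) hσ
  refine ⟨fun u hu => existsUnique_tInv_eq hγ hu, fun u => (analyticAt_t hγ u).differentiableAt,
    eventually_hasSum_f hγ hθ, c_even_im hγ, fun n hn => ?_, fun K => ?_⟩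
  -- Integrability does not depend on `K`, so any value serves.
  · obtain ⟨C, hC⟩ := hw 0
    exact (hC n hn).1
  · obtain ⟨C, hC⟩ := hw K
    refine ⟨1 / Real.pi * C, fun n hn => ?_⟩
    have hpi := Real.pi_pos
    have hterm : 1 / (2 * Real.sqrt Real.pi) *
        ∑ k ∈ Finset.range K, (c Ω e γ (2 * k)).re *
          (Real.Gamma ((k : ℝ) + 1 / 2) / Real.Gamma (1 / 2)) *
          (4 * Real.sinh γ / n) ^ ((k : ℝ) + 1 / 2) =
        1 / Real.pi * ∑ k ∈ Finset.range K, (c Ω e γ (2 * k)).re *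
          ((4 * Real.sinh γ / n) ^ ((k : ℝ) + 1 / 2) * (1 / 2) *
            Real.Gamma ((k : ℝ) + 1 / 2)) := by
      -- Since `Γ(1/2) = √π`, both prefactors equal `1 / (2π)` once `π` is written as `√π · √π`.
      rw [Finset.mul_sum, Finset.mul_sum, Real.Gamma_one_half_eq]
      refine Finset.sum_congr rfl fun k _ => ?_
      have hsq : Real.pi = Real.sqrt Real.pi * Real.sqrt Real.pi := (Real.mul_self_sqrt hpi.le).symm
      have hne : Real.sqrt Real.pi ≠ 0 := (Real.sqrt_pos.2 hpi).ne'
      have hinv : 1 / Real.pi = 1 / (Real.sqrt Real.pi * Real.sqrt Real.pi) := by rw [← hsq]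
      rw [hinv]
      field_simp
    rw [hterm, g, ← mul_sub, abs_mul, abs_of_pos (by positivity : 0 < 1 / Real.pi), mul_assoc]
    exact mul_le_mul_of_nonneg_left (hC n hn).2 (by positivity)
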